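/- Let $1<\alpha\le 2$, $0<\beta\le 1$, $\lambda,\mu\in\mathbb{R}$, and let $g:[0,\infty)\to\mathbb{R}$ be continuous. For $n-1<\nu\le n$, $n\in\mathbb{N}$, let $$({}^{C}D^{\nu}y)(t)=\frac{1}{\Gamma(n-\nu)}\int_0^t (t-s)^{n-\nu-1}y^{(n)}(s)\,ds\quad(\nu<n),\qquad {}^{C}D^{n}y=y^{(n)},$$ be the Caputo derivative, and let $$E_{a,b,c}(u,v)=\sum_{l=0}^{\infty}\sum_{k=0}^{\infty}\frac{(l+k)!}{l!\,k!}\,\frac{u^l v^k}{\Gamma(la+kb+c)}$$ be the bivariate Mittag-Leffler function. Consider the Cauchy problem $$({}^{C}D^{\alpha}y)(t)-\mu\,({}^{C}D^{\beta}y)(t)-\lambda y(t)=g(t)\quad(t>0),\qquad y(0)=y'(0)=0,\tag{P}$$ and put $$Y(t)=\int_0^t (t-s)^{\alpha-1}E_{\alpha,\alpha-\beta,\alpha}\bigl(\lambda(t-s)^{\alpha},\mu(t-s)^{\alpha-\beta}\bigr)g(s)\,ds,\qquad t\ge 0.$$ 1. A function $y\in C^2([0,\infty),\mathbb{R})$ solves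 (P) if and only if $y=Y$ on $[0,\infty)$. In particular (P) has at most one solution in $C^2([0,\infty),\mathbb{R})$, and it is given by $Y$. 2. The same equivalence holds in the larger class $\mathcal S$ of all $y\in C^1([0,\infty))\cap C^2((0,\infty))$ for which $y''$ is integrable on $(0,T]$ for every $T>0$. 3. If $g\in C^1([0,\infty))$, then $Y\in\mathcal S$ and $Y$ solves (P); so $Y$ is the unique solution of (P) in $\mathcal S$. 4. If $\alpha=2$, or if $g\in C^1([0,\infty))$ and $g(0)=0$, then $Y\in C^2([0,\infty))$ and $Y$ solves (P); so $Y$ is the unique solution of (P) in $C^2([0,\infty))$. -/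

import Mathlib

open Set MeasureTheory

noncomputable section

/-- The Riemann–Liouville fractional integral `(I^ν f)(t)` of order `ν` with base point `t₀`;
the integral of order zero is the identity, as usual. -/
def rlIntegral (t₀ ν : ℝ) (f : ℝ → ℝ) (t : ℝ) : ℝ :=
  if ν = 0 then f t
  else (1 / Real.Gamma ν) * ∫ s in t₀..t, (t - s) ^ (ν - 1) * f s

/-- The Caputo derivative of order `α > 0` with base point `t₀`: `I^(n-α)` applied to the `n`-th
derivative of `f`, where `n` is the integer with `n - 1 < α ≤ n`. It is used at points `t > t₀`
only, where the derivatives that enter are ordinary derivatives at points `s > t₀` (the end point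
`s = t₀` is a null set of the integral). -/
def caputoDeriv (t₀ α : ℝ) (f : ℝ → ℝ) (t : ℝ) : ℝ :=
  rlIntegral t₀ ((⌈α⌉₊ : ℝ) - α) (iteratedDeriv ⌈α⌉₊ f) t

/-- The bivariate Mittag-Leffler function `E_{α,β,γ}^δ(u,v)`; the Pochhammer symbol `(δ)_n` is
`ascPochhammer` evaluated at `δ`. -/
def bivariateMittagLeffler (α β γ δ u v : ℝ) : ℝ :=
  ∑' l : ℕ, ∑' k : ℕ,
    (ascPochhammer ℝ (l + k)).eval δ / Real.Gamma (l * α + k * β + γ)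
      * (u ^ l * v ^ k / ((l.factorial : ℝ) * (k.factorial : ℝ)))

/-- `y` satisfies `D^α y - μ D^β y - λ y = g` for `t > 0` (Caputo derivatives based at `0`) and
`y(0) = y'(0) = 0`, where `y'(0)` is the one-sided derivative. -/
structure IsBagleyTorvikSolution (α β lam mu : ℝ) (g y : ℝ → ℝ) : Prop where
  equation : ∀ t : ℝ, 0 < t →
    caputoDeriv 0 α y t - mu * caputoDeriv 0 β y t - lam * y t = g t
  value_zero : y 0 = 0
  deriv_zero : derivWithin y (Ici 0) 0 = 0

/-- The functions that are `C¹` on `[0,∞)` and `C²` on `(0,∞)`, with second derivative integrable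
on `(0,T]` for every `T`. Every function that is `C²` on `[0,∞)` is of this kind. -/
structure IsCaputoRegular (y : ℝ → ℝ) : Prop where
  contDiff_one : ContDiffOn ℝ 1 y (Ici 0)
  contDiff_two : ContDiffOn ℝ 2 y (Ioi 0)
  integrable_deriv : ∀ T : ℝ, 0 < T → IntegrableOn (iteratedDeriv 2 y) (Ioc 0 T)

/-- `y(t) = ∫₀ᵗ (t-s)^(α-1) E_{α,α-β,α}(λ(t-s)^α, μ(t-s)^(α-β)) g(s) ds`, where
`E_{α,β,γ}` stands for `E_{α,β,γ}^1`. -/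
def bagleyTorvikFormula (α β lam mu : ℝ) (g : ℝ → ℝ) (t : ℝ) : ℝ :=
  ∫ s in (0 : ℝ)..t, (t - s) ^ (α - 1)
    * bivariateMittagLeffler α (α - β) α 1 (lam * (t - s) ^ α) (mu * (t - s) ^ (α - β)) * g s

end

/-!
Everything takes place in the algebra of causal functions: functions on `ℝ` that vanish on `(-∞, 0]`,
are continuous on `(0, ∞)` and locally integrable. Convolution makes it a commutative, associative
algebra (`CausalKernel.conv`), the fractional integrals `I^ν` are convolutions with the kernels
`φ_ν(t) = t ^ (ν - 1) / Γ(ν)`, they satisfy `I^a I^b = I^(a+b)` (`CausalKernel.rlOp_add`), and each of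
them is injective (`CausalKernel.rlOp_injective`).

A regular function `y` with `y(0) = y'(0) = 0` is `I² y''`, and its Caputo derivatives are
`I^(2-α) y''` and `I^(1-β) I y''`. Applying `I^α` therefore turns the Cauchy problem into the Volterra
equation `y = I^α g + λ I^α y + μ I^(α-β) y` (`caputo_equation_iff_volterra`), and injectivity of `I^α`
makes this an equivalence. That the solutions of the Volterra equation satisfy `y'(0) = 0` follows by
differentiating it once, since `α > 1` and `α > β`.

Let `K_c(t) = t ^ (c - 1) E_{α,α-β,c}(λ t ^ α, μ t ^ (α-β))`. Grouping the double series by total degree,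
Pascal's rule gives `K_c = φ_c + λ K_{c+α} + μ K_{c+α-β}` (`CausalKernel.mlKernel_eq`), and termwise
integration gives `I^d K_c = K_{c+d}` (`CausalKernel.rlOp_mlKernel`). So `K_α` is the resolvent of the
Volterra equation, whose unique solution is `Y = K_α ⋆ g` (`CausalKernel.eq_volterra_iff`). This settles
the characterization of solutions in both classes.

For existence it remains to see that `Y` is regular, and for this it is written as a double integral
`I² w`. If `g` is `C¹`, then `w = g(0) K_{α-1} + K_{α-1} ⋆ g'`; the second term is continuous with value
`0` at the origin, so `Y` is `C²` up to `0` when `g(0) = 0`. If `α = 2`, then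
`w = g + (λ K_2 + μ K_{2-β}) ⋆ g`, which is continuous for every continuous `g`.
-/

open Filter Topology ContinuousLinearMap

open scoped Convolution

/-! ### The convolution algebra of causal functions -/

/-- The causal functions: real functions that vanish on `(-∞, 0]`, are continuous on `(0, ∞)` and
locally integrable (so they may be singular at `0+`). They are stored as functions on the whole line
so that convolution over the half line becomes the ordinary convolution on `ℝ`. -/
noncomputable def CausalKernel : Submodule ℝ (ℝ → ℝ) where
  carrier := {f | (∀ t ≤ 0, f t = 0) ∧ ContinuousOn f (Ioi 0) ∧ LocallyIntegrable f}
  add_mem' := fun {f g} hf hg =>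
    ⟨fun t ht => by simp [hf.1 t ht, hg.1 t ht], hf.2.1.add hg.2.1, hf.2.2.add hg.2.2⟩
  zero_mem' := ⟨fun _ _ => rfl, continuousOn_const, locallyIntegrable_zero⟩
  smul_mem' := fun c f hf =>
    ⟨fun t ht => by simp [hf.1 t ht], hf.2.1.const_smul c, by
      have := hf.2.2
      rw [locallyIntegrable_iff] at this ⊢
      exact fun k hk => (this k hk).smul c⟩

namespace CausalKernel

variable {f g : ℝ → ℝ}

theorem eq_zero (hf : f ∈ CausalKernel) {t : ℝ} (ht : t ≤ 0) : f t = 0 := hf.1 t ht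

theorem continuousOn (hf : f ∈ CausalKernel) : ContinuousOn f (Ioi 0) := hf.2.1

theorem locallyIntegrable (hf : f ∈ CausalKernel) : LocallyIntegrable f := hf.2.2

theorem aestronglyMeasurable (hf : f ∈ CausalKernel) : AEStronglyMeasurable f :=
  hf.2.2.aestronglyMeasurable

theorem norm_mem (hf : f ∈ CausalKernel) : (fun t => ‖f t‖) ∈ CausalKernel :=
  ⟨fun t ht => by simp [hf.1 t ht], hf.2.1.norm, by
    have := hf.2.2
    rw [locallyIntegrable_iff] at this ⊢
    exact fun k hk => (this k hk).norm⟩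

theorem mem_of_integrableOn (h0 : ∀ t ≤ 0, f t = 0) (hc : ContinuousOn f (Ioi 0))
    (hi : ∀ T, 0 < T → IntegrableOn f (Ioc 0 T)) : f ∈ CausalKernel := by
  refine ⟨h0, hc, fun x => ?_⟩
  refine ⟨Iic (|x| + 1), Iic_mem_nhds (by linarith [le_abs_self x]), ?_⟩
  have hsplit : Iic (|x| + 1) = Iic 0 ∪ Ioc 0 (|x| + 1) := by
    rw [Iic_union_Ioc_eq_Iic (by positivity)]
  rw [hsplit]
  refine IntegrableOn.union ?_ (hi _ (by positivity))
  exact (integrableOn_zero (ε' := ℝ)).congr_fun (fun t ht => (h0 t ht).symm) measurableSet_Iic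

theorem indicator_mem (hc : ContinuousOn f (Ioi 0))
    (hi : ∀ T, 0 < T → IntegrableOn f (Ioc 0 T)) : (Ioi 0).indicator f ∈ CausalKernel := by
  refine mem_of_integrableOn (fun t ht => indicator_of_notMem (by simpa using ht) _)
    (hc.congr fun t ht => indicator_of_mem ht _) fun T hT => ?_
  exact (hi T hT).congr_fun (fun t ht => (indicator_of_mem (mem_Ioi.2 ht.1) _).symm)
    measurableSet_Ioc

theorem indicator_mem_of_continuousOn (hc : ContinuousOn f (Ici 0)) :
    (Ioi 0).indicator f ∈ CausalKernel :=
  indicator_mem (hc.mono Ioi_subset_Ici_self) fun T _ =>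
    ((hc.mono Icc_subset_Ici_self).integrableOn_Icc (b := T)).mono_set Ioc_subset_Icc_self

/-- On `(0, x)` the first factor can be singular only near `0` and the second only near `x`, so the
integrand is integrable on each half of the interval. -/
theorem convolutionExistsAt (hf : f ∈ CausalKernel) (hg : g ∈ CausalKernel) (x : ℝ) :
    ConvolutionExistsAt f g x (mul ℝ ℝ) volume := by
  have hg' : LocallyIntegrable fun t => g (x - t) := by
    have := hg.2.2
    rw [MeasureTheory.locallyIntegrable_iff] at this ⊢
    intro k hk
    have h1 := this (k := (fun t => x - t) '' k) (hk.image (by fun_prop))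
    have h2 := (Measure.measurePreserving_sub_left (volume : Measure ℝ) x).integrableOn_comp_preimage
      (f := g) (s := (fun t => x - t) '' k) (MeasurableEquiv.subLeft x).measurableEmbedding
    have h3 := h2.2 h1
    exact h3.mono_set (subset_preimage_image _ _)
  have h1 : IntegrableOn (fun t => f t * g (x - t)) (Icc 0 (x / 2)) := by
    by_cases hx : 0 < x
    · refine (hf.2.2.integrableOn_isCompact isCompact_Icc).mul_continuousOn ?_ isCompact_Icc
      refine hg.2.1.comp (by fun_prop) fun t ht => ?_
      simp only [mem_Icc, mem_Ioi] at ht ⊢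
      linarith
    · have : Icc 0 (x / 2) ⊆ {0} := fun t ht => by
        simp only [mem_Icc, mem_singleton_iff] at ht ⊢
        linarith
      exact (integrableOn_singleton (hx := by simp)).mono_set this
  have h2 : IntegrableOn (fun t => f t * g (x - t)) (Icc (x / 2) x) := by
    by_cases hx : 0 < x
    · refine (hg'.integrableOn_isCompact isCompact_Icc).continuousOn_mul ?_ isCompact_Icc
      exact hf.2.1.mono fun t ht => by simp only [mem_Icc, mem_Ioi] at ht ⊢; linarith
    · have : Icc (x / 2) x ⊆ {0} := fun t ht => by
        simp only [mem_Icc, mem_singleton_iff] at ht ⊢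
        linarith
      exact (integrableOn_singleton (hx := by simp)).mono_set this
  rw [ConvolutionExistsAt]
  refine (integrableOn_iff_integrable_of_support_subset ?_).1 (h1.union h2)
  intro t ht
  simp only [mul_apply', Function.mem_support, ne_eq, mul_eq_zero, not_or] at ht
  have ht0 : 0 < t := not_le.1 fun h => ht.1 (hf.1 t h)
  have htx : 0 < x - t := not_le.1 fun h => ht.2 (hg.1 _ h)
  rcases le_total t (x / 2) with h | h
  · exact Or.inl ⟨ht0.le, h⟩
  · exact Or.inr ⟨h, by linarith⟩

theorem convolution_eq_zero (hf : f ∈ CausalKernel) (hg : g ∈ CausalKernel) {x : ℝ} (hx : x ≤ 0) :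
    (f ⋆[mul ℝ ℝ, volume] g) x = 0 := by
  rw [convolution_mul]
  refine integral_eq_zero_of_ae (Eventually.of_forall fun t => ?_)
  rcases le_total t 0 with h | h
  · simp [hf.1 t h]
  · simp [hg.1 (x - t) (by linarith)]

theorem convolution_eq_intervalIntegral (hf : f ∈ CausalKernel) (hg : g ∈ CausalKernel) {x : ℝ}
    (hx : 0 ≤ x) : (f ⋆[mul ℝ ℝ, volume] g) x = ∫ s in 0..x, f (x - s) * g s := by
  rw [convolution_mul_swap, intervalIntegral.integral_of_le hx]
  refine (setIntegral_eq_integral_of_forall_compl_eq_zero fun t ht => ?_).symm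
  simp only [mem_Ioc, not_and_or, not_lt, not_le] at ht
  rcases ht with h | h
  · simp [hg.1 t h]
  · simp [hf.1 (x - t) (by linarith)]

/-- Convolution with a function that is continuous up to `0` (and cut off to the left of `0`) is
continuous on the whole line, whatever the integrable singularity of the other factor. -/
theorem continuous_convolution_of_continuous (hf : f ∈ CausalKernel) (hg : Continuous g) :
    Continuous (f ⋆[mul ℝ ℝ, volume] (Ioi 0).indicator g) := by
  have hgm : (Ioi 0).indicator g ∈ CausalKernel := indicator_mem_of_continuousOn hg.continuousOn
  rw [continuous_iff_continuousAt]
  intro x₀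
  obtain ⟨C, hC⟩ := (isCompact_Icc (a := (0 : ℝ)) (b := |x₀| + 1)).exists_bound_of_continuousOn
    hg.continuousOn
  have hC0 : 0 ≤ C := (norm_nonneg _).trans (hC 0 ⟨le_rfl, by positivity⟩)
  show ContinuousAt (fun x => ∫ t, f t * (Ioi 0).indicator g (x - t)) x₀
  refine continuousAt_of_dominated (bound := (Icc 0 (|x₀| + 1)).indicator fun t => ‖f t‖ * C)
    (Eventually.of_forall fun x => (convolutionExistsAt hf hgm x).aestronglyMeasurable) ?_ ?_ ?_
  · have : ∀ᶠ x in 𝓝 x₀, x < |x₀| + 1 := Iio_mem_nhds (by linarith [le_abs_self x₀])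
    filter_upwards [this] with x hx
    refine Eventually.of_forall fun t => ?_
    by_cases ht : t ≤ 0
    · simp only [hf.1 t ht, zero_mul, norm_zero]
      exact indicator_nonneg (fun _ _ => by positivity) _
    by_cases hxt : x - t ≤ 0
    · rw [indicator_of_notMem (by simpa using hxt), mul_zero, norm_zero]
      exact indicator_nonneg (fun _ _ => by positivity) _
    push Not at ht hxt
    rw [indicator_of_mem (mem_Ioi.2 hxt), indicator_of_mem (mem_Icc.2 ⟨ht.le, by linarith⟩), norm_mul]
    gcongr
    exact hC _ ⟨hxt.le, by linarith⟩
  · exact IntegrableOn.integrable_indicator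
      ((hf.2.2.integrableOn_isCompact isCompact_Icc).norm.mul_const C) measurableSet_Icc
  -- the integrand is continuous at `x₀` unless the jump of the cut-off, at `x = t`, falls on `x₀`
  · have : ∀ᵐ t : ℝ, t ≠ x₀ := by simp [ae_iff, measure_singleton]
    filter_upwards [this] with t ht
    refine ContinuousAt.mul continuousAt_const ?_
    have hne : x₀ - t ≠ 0 := sub_ne_zero.2 ht.symm
    have h1 : ContinuousAt ((Ioi (0 : ℝ)).indicator g) (x₀ - t) := by
      rcases lt_or_gt_of_ne hne with h | h
      · refine (continuousAt_const (y := (0 : ℝ))).congr ?_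
        filter_upwards [Iio_mem_nhds h] with s hs
        exact (indicator_of_notMem (by simpa using hs.le) _).symm
      · refine hg.continuousAt.congr ?_
        filter_upwards [Ioi_mem_nhds h] with s hs
        exact (indicator_of_mem (mem_Ioi.2 hs) _).symm
    exact ContinuousAt.comp (f := fun x => x - t) h1 (by fun_prop)

/-- Both factors are split into a part supported in `(0, ε)` and a part continuous up to `0`. The two
singular parts do not interact beyond `2 ε`. -/
theorem continuousAt_convolution (hf : f ∈ CausalKernel) (hg : g ∈ CausalKernel) {x₀ : ℝ}
    (hx₀ : 0 < x₀) : ContinuousAt (f ⋆[mul ℝ ℝ, volume] g) x₀ := by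
  set ε := x₀ / 4 with hε
  have hε0 : 0 < ε := by positivity
  have key : ∀ f ∈ CausalKernel, ∃ F : ℝ → ℝ, Continuous F ∧ (∀ t, ε ≤ t → F t = f t) := by
    intro f hf
    refine ⟨fun t => f (max t ε), ?_, fun t ht => by simp [ht]⟩
    exact hf.2.1.comp_continuous (by fun_prop) fun t => lt_of_lt_of_le hε0 (le_max_right _ _)
  obtain ⟨F, hF, hFf⟩ := key f hf
  obtain ⟨G, hG, hGg⟩ := key g hg
  set f₁ := (Ioi (0 : ℝ)).indicator F
  set g₁ := (Ioi (0 : ℝ)).indicator G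
  have hf₁ : f₁ ∈ CausalKernel := indicator_mem_of_continuousOn hF.continuousOn
  have hg₁ : g₁ ∈ CausalKernel := indicator_mem_of_continuousOn hG.continuousOn
  have hf₀ : f - f₁ ∈ CausalKernel := CausalKernel.sub_mem hf hf₁
  have hg₀ : g - g₁ ∈ CausalKernel := CausalKernel.sub_mem hg hg₁
  have hc : ContinuousAt (fun x => (f ⋆[mul ℝ ℝ, volume] g₁) x +
      ((g - g₁) ⋆[mul ℝ ℝ, volume] f₁) x) x₀ :=
    (continuous_convolution_of_continuous hf hG).continuousAt.add
      (continuous_convolution_of_continuous hg₀ hF).continuousAt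
  refine hc.congr ?_
  filter_upwards [Ioi_mem_nhds (show 2 * ε < x₀ by rw [hε]; linarith)] with x hx
  have hx' : 2 * ε < x := hx
  have e1 : (f ⋆[mul ℝ ℝ, volume] g) x = (f ⋆[mul ℝ ℝ, volume] g₁) x +
      (f ⋆[mul ℝ ℝ, volume] (g - g₁)) x := by
    rw [← (convolutionExistsAt hf hg₁ x).distrib_add (convolutionExistsAt hf hg₀ x)]
    simp
  have e2 : (f ⋆[mul ℝ ℝ, volume] (g - g₁)) x = (f₁ ⋆[mul ℝ ℝ, volume] (g - g₁)) x +
      ((f - f₁) ⋆[mul ℝ ℝ, volume] (g - g₁)) x := by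
    rw [← (convolutionExistsAt hf₁ hg₀ x).add_distrib (convolutionExistsAt hf₀ hg₀ x)]
    simp
  -- both factors of the last term are supported in `(0, ε)`, so it vanishes beyond `2 ε`
  have e3 : ((f - f₁) ⋆[mul ℝ ℝ, volume] (g - g₁)) x = 0 := by
    rw [convolution_mul]
    refine integral_eq_zero_of_ae (Eventually.of_forall fun t => ?_)
    rcases le_total ε t with h | h
    · simp [f₁, hε0.trans_le h, hFf t h]
    · have h' : ε ≤ x - t := by linarith
      have h'' : t < x := by linarith
      simp [g₁, h'', hGg _ h']
  have e4 : (f₁ ⋆[mul ℝ ℝ, volume] (g - g₁)) x = ((g - g₁) ⋆[mul ℝ ℝ, volume] f₁) x := by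
    rw [convolution_mul, convolution_mul_swap]
    simp only [mul_comm]
  simp only [e1, e2, e3, e4, add_zero]

/-- On `(0, T]` the convolution only sees the restrictions of the factors to `(0, T]`, which are
integrable. -/
theorem convolution_mem (hf : f ∈ CausalKernel) (hg : g ∈ CausalKernel) :
    (f ⋆[mul ℝ ℝ, volume] g) ∈ CausalKernel := by
  refine mem_of_integrableOn (fun t ht => convolution_eq_zero hf hg ht)
    (fun t ht => (continuousAt_convolution hf hg ht).continuousWithinAt) fun T hT => ?_
  have key : ∀ f ∈ CausalKernel, Integrable ((Ioc 0 T).indicator f) := fun f hf =>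
    ((hf.2.2.integrableOn_isCompact isCompact_Icc).mono_set Ioc_subset_Icc_self).integrable_indicator
      measurableSet_Ioc
  refine (((key f hf).integrable_convolution (mul ℝ ℝ) (key g hg)).integrableOn).congr_fun
    (fun x hx => ?_) measurableSet_Ioc
  rw [convolution_mul, convolution_mul]
  refine integral_congr_ae (Eventually.of_forall fun t => ?_)
  have hxT : x ≤ T := hx.2
  by_cases ht : t ≤ 0
  · simp [hf.1 t ht, ht]
  by_cases hxt : x - t ≤ 0
  · simp [hg.1 _ hxt]
  push Not at ht hxt
  have h1 : t ∈ Ioc 0 T := ⟨ht, by linarith⟩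
  have h2 : x - t ∈ Ioc 0 T := ⟨hxt, by linarith⟩
  simp only [indicator_of_mem h1, indicator_of_mem h2]

/-- The convolution product `(f ⋆ g)(t) = ∫₀ᵗ f(t-s) g(s) ds` of causal functions, as a bilinear map. -/
noncomputable def conv : CausalKernel →ₗ[ℝ] CausalKernel →ₗ[ℝ] CausalKernel :=
  LinearMap.mk₂ ℝ (fun f g => ⟨f.1 ⋆[mul ℝ ℝ, volume] g.1, convolution_mem f.2 g.2⟩)
    (fun f f' g => Subtype.ext <| ConvolutionExists.add_distrib
      (convolutionExistsAt f.2 g.2) (convolutionExistsAt f'.2 g.2))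
    (fun _ _ _ => Subtype.ext <| smul_convolution)
    (fun f g g' => Subtype.ext <| ConvolutionExists.distrib_add
      (convolutionExistsAt f.2 g.2) (convolutionExistsAt f.2 g'.2))
    (fun _ _ _ => Subtype.ext <| convolution_smul)

theorem coe_conv (f g : CausalKernel) : (conv f g : ℝ → ℝ) = f.1 ⋆[mul ℝ ℝ, volume] g.1 := rfl

theorem conv_apply (f g : CausalKernel) {x : ℝ} (hx : 0 ≤ x) :
    (conv f g : ℝ → ℝ) x = ∫ s in 0..x, f.1 (x - s) * g.1 s :=
  convolution_eq_intervalIntegral f.2 g.2 hx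

theorem conv_comm (f g : CausalKernel) : conv f g = conv g f := by
  refine Subtype.ext (funext fun x => ?_)
  rw [coe_conv, coe_conv, convolution_mul, convolution_mul_swap]
  simp only [mul_comm]

/-- Fubini's theorem applies at every point, since the absolute values of the factors are causal
functions too. -/
theorem conv_assoc (f g h : CausalKernel) : conv (conv f g) h = conv f (conv g h) := by
  refine Subtype.ext (funext fun x => ?_)
  refine convolution_assoc (mul ℝ ℝ) (mul ℝ ℝ) (mul ℝ ℝ) (mul ℝ ℝ) (fun x y z => mul_assoc x y z)
    (aestronglyMeasurable f.2) (aestronglyMeasurable g.2) (aestronglyMeasurable h.2)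
    (Eventually.of_forall (convolutionExistsAt f.2 g.2))
    (Eventually.of_forall (convolutionExistsAt (norm_mem g.2) (norm_mem h.2)))
    (convolutionExistsAt (norm_mem f.2) (convolution_mem (norm_mem g.2) (norm_mem h.2)) x)

end CausalKernel

namespace CausalKernel

theorem ext_pos {f g : CausalKernel} (h : ∀ t, 0 < t → f.1 t = g.1 t) : f = g := by
  refine Subtype.ext (funext fun t => ?_)
  rcases le_or_gt t 0 with ht | ht
  · rw [eq_zero f.2 ht, eq_zero g.2 ht]
  · exact h t ht

theorem intervalIntegrable (f : CausalKernel) (a b : ℝ) : IntervalIntegrable f.1 volume a b :=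
  (((locallyIntegrable f.2).integrableOn_isCompact isCompact_uIcc)).intervalIntegrable

theorem continuousAt (f : CausalKernel) {t : ℝ} (ht : 0 < t) : ContinuousAt f.1 t :=
  (continuousOn f.2).continuousAt (Ioi_mem_nhds ht)

/-- Convolution with a causal function that extends continuously to `[0, ∞)` is continuous across
`0`. -/
theorem continuous_conv_of_eqOn (f g : CausalKernel) {G : ℝ → ℝ} (hG : ContinuousOn G (Ici 0))
    (hg : EqOn g.1 G (Ioi 0)) : Continuous (conv f g).1 := by
  have hG' : Continuous fun t => G (max t 0) :=
    hG.comp_continuous (by fun_prop) fun t => mem_Ici.2 (le_max_right t 0)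
  have h := continuous_convolution_of_continuous f.2 hG'
  have e : (Ioi (0 : ℝ)).indicator (fun t => G (max t 0)) = g.1 := by
    ext t
    by_cases ht : 0 < t
    · rw [indicator_of_mem (mem_Ioi.2 ht), hg ht, max_eq_left ht.le]
    · rw [indicator_of_notMem (by simpa using ht), eq_zero g.2 (not_lt.1 ht)]
  rwa [e] at h

/-! ### Fractional integration -/

/-- The Riemann–Liouville kernel `t ^ (ν - 1) / Γ(ν)` on `(0, ∞)`, for `ν > 0`; it is set to `0` for
`ν ≤ 0`. -/
noncomputable def rlKernel (ν : ℝ) : CausalKernel :=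
  if hν : 0 < ν then
    ⟨(Ioi 0).indicator fun t => t ^ (ν - 1) / Real.Gamma ν, indicator_mem
      (ContinuousOn.div_const (fun t ht =>
        (Real.continuousAt_rpow_const t (ν - 1) (Or.inl (ne_of_gt ht))).continuousWithinAt) _)
      fun T hT => (intervalIntegrable_iff_integrableOn_Ioc_of_le hT.le).1
        ((intervalIntegral.intervalIntegrable_rpow' (by linarith)).div_const _)⟩
  else 0

theorem rlKernel_apply {ν t : ℝ} (hν : 0 < ν) (ht : 0 < t) :
    (rlKernel ν).1 t = t ^ (ν - 1) / Real.Gamma ν := by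
  rw [rlKernel, dif_pos hν]
  exact indicator_of_mem (s := Ioi (0 : ℝ)) ht (fun t => t ^ (ν - 1) / Real.Gamma ν)

theorem rlKernel_nonneg (ν t : ℝ) : 0 ≤ (rlKernel ν).1 t := by
  rcases le_or_gt t 0 with ht | ht
  · exact (eq_zero (rlKernel ν).2 ht).ge
  by_cases hν : 0 < ν
  · rw [rlKernel_apply hν ht]
    have := Real.Gamma_pos_of_pos hν
    positivity
  · simp [rlKernel, hν]

theorem integral_rpow_mul_rpow {a b t : ℝ} (ha : 0 < a) (hb : 0 < b) (ht : 0 < t) :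
    ∫ s in 0..t, (t - s) ^ (a - 1) * s ^ (b - 1) =
      t ^ (a + b - 1) * (Real.Gamma a * Real.Gamma b / Real.Gamma (a + b)) := by
  apply Complex.ofReal_injective
  rw [← intervalIntegral.integral_ofReal]
  have h := Complex.betaIntegral_scaled b a ht
  rw [Complex.betaIntegral_eq_Gamma_mul_div _ _ (by simpa) (by simpa)] at h
  have e : ∫ s in 0..t, (((t - s) ^ (a - 1) * s ^ (b - 1) : ℝ) : ℂ) =
      ∫ s in 0..t, (s : ℂ) ^ ((b : ℂ) - 1) * ((t : ℂ) - s) ^ ((a : ℂ) - 1) := by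
    refine intervalIntegral.integral_congr fun s hs => ?_
    rw [uIcc_of_le ht.le] at hs
    simp only [Complex.ofReal_mul]
    rw [Complex.ofReal_cpow (sub_nonneg.2 hs.2), Complex.ofReal_cpow hs.1]
    push_cast
    ring
  rw [e, h, Complex.ofReal_mul, Complex.ofReal_cpow ht.le, Complex.ofReal_div, Complex.ofReal_mul,
    ← Complex.Gamma_ofReal, ← Complex.Gamma_ofReal, ← Complex.Gamma_ofReal]
  push_cast
  rw [add_comm (b : ℂ) a, mul_comm (Complex.Gamma b)]

/-- The semigroup law of the Riemann–Liouville kernels, which is Euler's beta integral. -/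
theorem conv_rlKernel {a b : ℝ} (ha : 0 < a) (hb : 0 < b) :
    conv (rlKernel a) (rlKernel b) = rlKernel (a + b) := by
  refine ext_pos fun t ht => ?_
  rw [conv_apply _ _ ht.le, rlKernel_apply (by positivity) ht]
  have e : ∫ s in 0..t, (rlKernel a).1 (t - s) * (rlKernel b).1 s =
      ∫ s in 0..t, ((t - s) ^ (a - 1) * s ^ (b - 1)) * (1 / (Real.Gamma a * Real.Gamma b)) := by
    refine intervalIntegral.integral_congr_ae ?_
    have : ∀ᵐ s : ℝ, s ≠ t := by simp [ae_iff, measure_singleton]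
    filter_upwards [this] with s hst hs
    rw [uIoc_of_le ht.le] at hs
    have : s < t := lt_of_le_of_ne hs.2 hst
    rw [rlKernel_apply ha (by linarith), rlKernel_apply hb hs.1]
    field_simp
  rw [e, intervalIntegral.integral_mul_const, integral_rpow_mul_rpow ha hb ht]
  have h1 := (Real.Gamma_pos_of_pos ha).ne'
  have h2 := (Real.Gamma_pos_of_pos hb).ne'
  field_simp

/-- The fractional integral of order `ν ≥ 0` on causal functions: convolution with `rlKernel ν`, and
the identity for `ν = 0`. -/
noncomputable def rlOp (ν : ℝ) : CausalKernel →ₗ[ℝ] CausalKernel :=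
  if ν = 0 then LinearMap.id else conv (rlKernel ν)

theorem rlOp_zero (f : CausalKernel) : rlOp 0 f = f := by simp [rlOp]

theorem rlOp_of_pos {ν : ℝ} (hν : 0 < ν) (f : CausalKernel) :
    rlOp ν f = conv (rlKernel ν) f := by simp [rlOp, hν.ne']

theorem rlOp_add {a b : ℝ} (ha : 0 ≤ a) (hb : 0 ≤ b) (f : CausalKernel) :
    rlOp (a + b) f = rlOp a (rlOp b f) := by
  rcases ha.eq_or_lt with rfl | ha
  · rw [zero_add, rlOp_zero]
  rcases hb.eq_or_lt with rfl | hb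
  · rw [add_zero, rlOp_zero]
  rw [rlOp_of_pos ha, rlOp_of_pos hb, rlOp_of_pos (by positivity), ← conv_assoc,
    conv_rlKernel ha hb]

theorem rlOp_comm {a b : ℝ} (ha : 0 ≤ a) (hb : 0 ≤ b) (f : CausalKernel) :
    rlOp a (rlOp b f) = rlOp b (rlOp a f) := by
  rw [← rlOp_add ha hb, add_comm, rlOp_add hb ha]

theorem rlOp_conv_left {ν : ℝ} (hν : 0 ≤ ν) (f g : CausalKernel) :
    rlOp ν (conv f g) = conv (rlOp ν f) g := by
  rcases hν.eq_or_lt with rfl | hν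
  · simp only [rlOp_zero]
  · rw [rlOp_of_pos hν, rlOp_of_pos hν, conv_assoc]

theorem rlOp_conv_right {ν : ℝ} (hν : 0 ≤ ν) (f g : CausalKernel) :
    rlOp ν (conv f g) = conv f (rlOp ν g) := by
  rw [conv_comm, rlOp_conv_left hν, conv_comm]

theorem rlOp_rlKernel {a b : ℝ} (ha : 0 ≤ a) (hb : 0 < b) :
    rlOp a (rlKernel b) = rlKernel (a + b) := by
  rcases ha.eq_or_lt with rfl | ha
  · rw [zero_add, rlOp_zero]
  · rw [rlOp_of_pos ha, conv_rlKernel ha hb]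

theorem rlOp_one_apply (f : CausalKernel) {t : ℝ} (ht : 0 ≤ t) :
    (rlOp 1 f).1 t = ∫ s in 0..t, f.1 s := by
  rw [rlOp_of_pos one_pos, conv_apply _ _ ht]
  refine intervalIntegral.integral_congr_ae ?_
  have : ∀ᵐ s : ℝ, s ≠ t := by simp [ae_iff, measure_singleton]
  filter_upwards [this] with s hst hs
  rw [uIoc_of_le ht] at hs
  have : s < t := lt_of_le_of_ne hs.2 hst
  rw [rlKernel_apply one_pos (by linarith)]
  simp

theorem continuous_rlOp_one (f : CausalKernel) : Continuous (rlOp 1 f).1 := by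
  rw [rlOp_of_pos one_pos, conv_comm]
  refine continuous_conv_of_eqOn _ _ (G := fun _ => 1) continuousOn_const fun t ht => ?_
  rw [rlKernel_apply one_pos ht]
  simp

theorem hasDerivAt_rlOp_one (f : CausalKernel) {t : ℝ} (ht : 0 < t) :
    HasDerivAt (rlOp 1 f).1 (f.1 t) t := by
  have h := intervalIntegral.integral_hasDerivAt_right (intervalIntegrable f 0 t)
    (ContinuousOn.stronglyMeasurableAtFilter isOpen_Ioi (continuousOn f.2) t ht) (continuousAt f ht)
  refine h.congr_of_eventuallyEq ?_
  filter_upwards [Ioi_mem_nhds ht] with s hs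
  exact rlOp_one_apply f (le_of_lt hs)

theorem eq_rlOp_one {F : ℝ → ℝ} (f : CausalKernel) (hF : ContinuousOn F (Ici 0)) (h0 : F 0 = 0)
    (hd : ∀ t, 0 < t → HasDerivAt F (f.1 t) t) {t : ℝ} (ht : 0 ≤ t) : F t = (rlOp 1 f).1 t := by
  rw [rlOp_one_apply f ht, intervalIntegral.integral_eq_sub_of_hasDerivAt_of_le ht
    (hF.mono Icc_subset_Ici_self) (fun s hs => hd s hs.1) (intervalIntegrable f 0 t), h0, sub_zero]

theorem rlOp_one_injective : Function.Injective (rlOp 1) := by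
  refine (injective_iff_map_eq_zero _).2 fun f hf => ext_pos fun t ht => ?_
  have h := hasDerivAt_rlOp_one f ht
  rw [hf] at h
  exact h.unique (hasDerivAt_const t (0 : ℝ))

theorem rlOp_natCast_injective (n : ℕ) : Function.Injective (rlOp n) := by
  induction n with
  | zero => exact fun f g h => by simpa only [Nat.cast_zero, rlOp_zero] using h
  | succ n ih =>
    intro f g h
    rw [Nat.cast_succ, add_comm, rlOp_add zero_le_one n.cast_nonneg,
      rlOp_add zero_le_one n.cast_nonneg] at h
    exact ih (rlOp_one_injective h)

/-- Raising the order to an integer reduces the claim to ordinary integration, which is inverted by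
differentiation since causal functions are continuous on `(0, ∞)`. -/
theorem rlOp_injective {ν : ℝ} (hν : 0 ≤ ν) : Function.Injective (rlOp ν) := by
  intro f g h
  have hc : 0 ≤ (⌈ν⌉₊ : ℝ) - ν := sub_nonneg.2 (Nat.le_ceil ν)
  apply rlOp_natCast_injective ⌈ν⌉₊
  rw [← sub_add_cancel (⌈ν⌉₊ : ℝ) ν, rlOp_add hc hν, rlOp_add hc hν, h]

/-- At `t > 0` the operator `rlIntegral` depends on `F` only through its values on `(0, ∞)`. -/
theorem rlIntegral_eq_rlOp {ν t : ℝ} (hν : 0 ≤ ν) (ht : 0 < t) {F : ℝ → ℝ} (f : CausalKernel)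
    (hf : EqOn F f.1 (Ioi 0)) : rlIntegral 0 ν F t = (rlOp ν f).1 t := by
  rcases hν.eq_or_lt with rfl | hν
  · rw [rlIntegral, if_pos rfl, rlOp_zero, hf ht]
  rw [rlIntegral, if_neg hν.ne', rlOp_of_pos hν, conv_apply _ _ ht.le,
    ← intervalIntegral.integral_const_mul]
  refine intervalIntegral.integral_congr_ae ?_
  have : ∀ᵐ s : ℝ, s ≠ t := by simp [ae_iff, measure_singleton]
  filter_upwards [this] with s hst hs
  rw [uIoc_of_le ht.le] at hs
  have : s < t := lt_of_le_of_ne hs.2 hst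
  rw [rlKernel_apply hν (by linarith), hf hs.1]
  ring

end CausalKernel

/-! ### The bivariate Mittag-Leffler kernel -/

/-- A bound on `1 / Γ` with a free parameter: for `s ≥ 1`, bound the integral for `Γ(s)` below by its
part over `(R, ∞)`; the case `s < 1` follows from `Γ(s + 1) = s Γ(s)`. Large `R` makes a series of
terms `T ^ s / Γ(s)` geometric. -/
theorem Real.inv_Gamma_le_exp_mul_rpow {R s : ℝ} (hR : 1 ≤ R) (hs : 0 < s) :
    (Real.Gamma s)⁻¹ ≤ Real.exp R * R ^ (1 - s) := by
  have hR0 : 0 < R := by linarith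
  have key : ∀ s : ℝ, 1 ≤ s → (Real.Gamma s)⁻¹ ≤ Real.exp R * R ^ (1 - s) := by
    intro s hs
    have hs0 : 0 < s := by linarith
    have h1 : R ^ (s - 1) * Real.exp (-R) ≤ Real.Gamma s := by
      rw [Real.Gamma_eq_integral hs0, ← integral_exp_neg_Ioi R, ← integral_const_mul]
      calc ∫ x in Ioi R, R ^ (s - 1) * Real.exp (-x)
          ≤ ∫ x in Ioi R, Real.exp (-x) * x ^ (s - 1) := by
            refine setIntegral_mono_on ((integrableOn_exp_neg_Ioi R).const_mul _)
              ((Real.GammaIntegral_convergent hs0).mono_set (Ioi_subset_Ioi hR0.le))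
              measurableSet_Ioi fun x hx => ?_
            rw [mul_comm]
            gcongr
            exact le_of_lt hx
        _ ≤ ∫ x in Ioi 0, Real.exp (-x) * x ^ (s - 1) := by
            refine setIntegral_mono_set (Real.GammaIntegral_convergent hs0) ?_
              (LE.le.eventuallyLE (Ioi_subset_Ioi hR0.le))
            filter_upwards [ae_restrict_mem measurableSet_Ioi] with x hx
            have : 0 < x := hx
            simp only [Pi.zero_apply]
            positivity
    calc (Real.Gamma s)⁻¹ ≤ (R ^ (s - 1) * Real.exp (-R))⁻¹ := by gcongr
      _ = Real.exp R * R ^ (1 - s) := by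
        rw [mul_inv, Real.exp_neg, inv_inv, ← Real.rpow_neg hR0.le, neg_sub, mul_comm]
  rcases le_total 1 s with h | h
  · exact key s h
  · have h1 := key (s + 1) (by linarith)
    rw [Real.Gamma_add_one hs.ne', mul_inv] at h1
    have hG : 0 < (Real.Gamma s)⁻¹ := inv_pos.2 (Real.Gamma_pos_of_pos hs)
    calc (Real.Gamma s)⁻¹ = s * (s⁻¹ * (Real.Gamma s)⁻¹) := by field_simp
      _ ≤ 1 * (Real.exp R * R ^ (1 - (s + 1))) := by gcongr
      _ ≤ Real.exp R * R ^ (1 - s) := by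
        rw [one_mul]
        gcongr
        linarith

namespace CausalKernel

/-- The `n`-th homogeneous part of the bivariate Mittag-Leffler series: the sum over `i + j = n` of
`(n choose i) lam^i mu^j` times the Riemann–Liouville kernel of order `i a + j b + c`, that is
`(lam I^a + mu I^b)^n` applied to the kernel of order `c`. -/
noncomputable def mlTerm (a b lam mu c : ℝ) (n : ℕ) : CausalKernel :=
  ∑ ij ∈ Finset.HasAntidiagonal.antidiagonal n,
    n.choose ij.1 • ((lam ^ ij.1 * mu ^ ij.2) • rlKernel (ij.1 * a + ij.2 * b + c))

variable {a b c d : ℝ} (lam mu : ℝ)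

theorem mlTerm_zero : mlTerm a b lam mu c 0 = rlKernel c := by
  simp [mlTerm]

theorem mlTerm_succ (n : ℕ) : mlTerm a b lam mu c (n + 1) =
    lam • mlTerm a b lam mu (c + a) n + mu • mlTerm a b lam mu (c + b) n := by
  have h := Finset.sum_antidiagonal_choose_succ_nsmul
    (fun i j : ℕ => (lam ^ i * mu ^ j) • rlKernel (i * a + j * b + c)) n
  rw [mlTerm, h, add_comm, mlTerm, mlTerm, Finset.smul_sum, Finset.smul_sum]
  congr 1
  · refine Finset.sum_congr rfl fun ij hij => ?_
    rw [← n.choose_symm_of_eq_add (Finset.HasAntidiagonal.mem_antidiagonal.1 hij).symm,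
      smul_comm lam, smul_smul]
    congr 2
    · ring
    · congr 1
      push_cast
      ring
  · refine Finset.sum_congr rfl fun ij hij => ?_
    rw [smul_comm mu, smul_smul]
    congr 2
    · ring
    · congr 1
      push_cast
      ring

theorem rlOp_mlTerm (ha : 0 < a) (hb : 0 < b) (hc : 0 < c) (hd : 0 ≤ d) (n : ℕ) :
    rlOp d (mlTerm a b lam mu c n) = mlTerm a b lam mu (c + d) n := by
  rw [mlTerm, mlTerm, map_sum]
  refine Finset.sum_congr rfl fun ij _ => ?_
  rw [map_nsmul, map_smul, rlOp_rlKernel hd (by positivity)]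
  congr 3
  ring

/-- The homogeneous parts, taken with absolute values, decay geometrically on `(-∞, T]` relative to
the kernel of order `c`. This is the source of every summability statement about the series. -/
theorem exists_rlKernel_le (ha : 0 < a) (hb : 0 < b) (hc : 0 < c) {T : ℝ} (hT : 0 < T) :
    ∃ M : ℝ, 0 ≤ M ∧ ∀ (n : ℕ) (t : ℝ), t ≤ T →
      ∑ ij ∈ Finset.HasAntidiagonal.antidiagonal n, (n.choose ij.1 : ℝ) *
        (|lam| ^ ij.1 * |mu| ^ ij.2 * (rlKernel (ij.1 * a + ij.2 * b + c)).1 t) ≤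
      M * (1 / 2) ^ n * (rlKernel c).1 t := by
  -- the ratio of the dominating geometric series is made at most `1 / 2`
  obtain ⟨R, hR, hR1⟩ : ∃ R : ℝ, |lam| * (T / R) ^ a + |mu| * (T / R) ^ b ≤ 1 / 2 ∧ 1 ≤ R := by
    have h0 : Tendsto (fun R : ℝ => T / R) atTop (𝓝 0) := tendsto_const_nhds.div_atTop tendsto_id
    have h1 : ∀ p : ℝ, 0 < p → Tendsto (fun R : ℝ => (T / R) ^ p) atTop (𝓝 0) := by
      intro p hp
      have := (Real.continuousAt_rpow_const 0 p (Or.inr hp.le)).tendsto.comp h0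
      rwa [Real.zero_rpow hp.ne'] at this
    have h2 := ((h1 a ha).const_mul |lam|).add ((h1 b hb).const_mul |mu|)
    rw [mul_zero, mul_zero, add_zero] at h2
    exact ((h2.eventually_le_const (by norm_num)).and (eventually_ge_atTop 1)).exists
  have hR0 : 0 < R := by linarith
  have hG := Real.Gamma_pos_of_pos hc
  refine ⟨Real.exp R * R ^ (1 - c) * Real.Gamma c, by positivity, fun n t htT => ?_⟩
  rcases le_or_gt t 0 with ht | ht
  · simp [eq_zero (rlKernel _).2 ht]
  set x := |lam| * (T / R) ^ a
  set y := |mu| * (T / R) ^ b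
  have hterm : ∀ ij : ℕ × ℕ, |lam| ^ ij.1 * |mu| ^ ij.2 *
      (rlKernel (ij.1 * a + ij.2 * b + c)).1 t ≤
      (Real.exp R * R ^ (1 - c) * t ^ (c - 1)) * (x ^ ij.1 * y ^ ij.2) := by
    intro ij
    set s : ℝ := ij.1 * a + ij.2 * b with hs
    have hs0 : 0 ≤ s := by positivity
    have h1 : (rlKernel (s + c)).1 t ≤ Real.exp R * R ^ (1 - c) * t ^ (c - 1) * (T / R) ^ s := by
      rw [rlKernel_apply (by positivity) ht, div_eq_mul_inv, Real.div_rpow hT.le hR0.le]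
      calc t ^ (s + c - 1) * (Real.Gamma (s + c))⁻¹
          ≤ (t ^ (c - 1) * T ^ s) * (Real.exp R * R ^ (1 - (s + c))) := by
            gcongr
            · rw [show s + c - 1 = (c - 1) + s by ring, Real.rpow_add ht]
              gcongr
            · exact Real.inv_Gamma_le_exp_mul_rpow hR1 (by positivity)
        _ = _ := by
          rw [show 1 - (s + c) = (1 - c) - s by ring, Real.rpow_sub hR0]
          ring
    calc |lam| ^ ij.1 * |mu| ^ ij.2 * (rlKernel (s + c)).1 t
        ≤ |lam| ^ ij.1 * |mu| ^ ij.2 *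
          (Real.exp R * R ^ (1 - c) * t ^ (c - 1) * (T / R) ^ s) := by gcongr
      _ = _ := by
        have hTR : 0 < T / R := by positivity
        rw [hs, Real.rpow_add hTR, mul_comm (ij.1 : ℝ), mul_comm (ij.2 : ℝ),
          Real.rpow_mul hTR.le, Real.rpow_mul hTR.le, Real.rpow_natCast, Real.rpow_natCast,
          mul_pow, mul_pow]
        ring
  calc _ ≤ ∑ ij ∈ Finset.HasAntidiagonal.antidiagonal n, (n.choose ij.1 : ℝ) *
        ((Real.exp R * R ^ (1 - c) * t ^ (c - 1)) * (x ^ ij.1 * y ^ ij.2)) := by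
        exact Finset.sum_le_sum fun ij _ =>
          mul_le_mul_of_nonneg_left (hterm ij) (Nat.cast_nonneg _)
    _ = (Real.exp R * R ^ (1 - c) * t ^ (c - 1)) * (x + y) ^ n := by
        rw [(Commute.all x y).add_pow', Finset.mul_sum]
        refine Finset.sum_congr rfl fun ij _ => ?_
        rw [nsmul_eq_mul]
        ring
    _ ≤ (Real.exp R * R ^ (1 - c) * t ^ (c - 1)) * (1 / 2) ^ n := by gcongr
    _ = _ := by
        rw [rlKernel_apply hc ht]
        field_simp

theorem coe_mlTerm (n : ℕ) (t : ℝ) : (mlTerm a b lam mu c n).1 t =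
    ∑ ij ∈ Finset.HasAntidiagonal.antidiagonal n, (n.choose ij.1 : ℝ) *
        (lam ^ ij.1 * mu ^ ij.2 * (rlKernel (ij.1 * a + ij.2 * b + c)).1 t) := by
  rw [mlTerm, Submodule.coe_sum, Finset.sum_apply]
  refine Finset.sum_congr rfl fun ij _ => ?_
  rw [← Nat.cast_smul_eq_nsmul ℝ]
  rfl

theorem exists_abs_mlTerm_le (ha : 0 < a) (hb : 0 < b) (hc : 0 < c) {T : ℝ} (hT : 0 < T) :
    ∃ M : ℝ, 0 ≤ M ∧ ∀ (n : ℕ) (t : ℝ), t ≤ T →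
      |(mlTerm a b lam mu c n).1 t| ≤ M * (1 / 2) ^ n * (rlKernel c).1 t := by
  obtain ⟨M, hM, h⟩ := exists_rlKernel_le lam mu ha hb hc hT
  refine ⟨M, hM, fun n t ht => le_trans ?_ (h n t ht)⟩
  rw [coe_mlTerm]
  refine (Finset.abs_sum_le_sum_abs _ _).trans (Finset.sum_le_sum fun ij _ => le_of_eq ?_)
  rw [abs_mul, abs_mul, abs_mul, abs_pow, abs_pow, abs_of_nonneg (rlKernel_nonneg _ _),
    Nat.abs_cast]

theorem summable_mlTerm (ha : 0 < a) (hb : 0 < b) (hc : 0 < c) (t : ℝ) :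
    Summable fun n => (mlTerm a b lam mu c n).1 t := by
  obtain ⟨M, -, h⟩ := exists_abs_mlTerm_le lam mu ha hb hc (T := |t| + 1) (by positivity)
  refine Summable.of_norm_bounded
    ((summable_geometric_two.mul_left M).mul_right ((rlKernel c).1 t)) fun n => ?_
  exact h n t (by linarith [le_abs_self t])

theorem tsum_mlTerm_mem (ha : 0 < a) (hb : 0 < b) (hc : 0 < c) :
    (fun t => ∑' n, (mlTerm a b lam mu c n).1 t) ∈ CausalKernel := by
  have hcont : ContinuousOn (fun t => ∑' n, (mlTerm a b lam mu c n).1 t) (Ioi 0) := by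
    intro t₀ ht₀
    have ht₀' : 0 < t₀ := ht₀
    obtain ⟨M, hM, h⟩ := exists_abs_mlTerm_le lam mu ha hb hc (T := t₀ + 1) (by positivity)
    have hsub : Icc (t₀ / 2) (t₀ + 1) ⊆ Ioi 0 := fun t ht => by
      simp only [mem_Icc, mem_Ioi] at ht ⊢; linarith
    obtain ⟨C, hC⟩ := isCompact_Icc.exists_bound_of_continuousOn
      ((continuousOn (rlKernel c).2).mono hsub)
    have hct : ContinuousOn (fun t => ∑' n, (mlTerm a b lam mu c n).1 t)
        (Icc (t₀ / 2) (t₀ + 1)) := by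
      refine continuousOn_tsum (u := fun n => M * (1 / 2) ^ n * C)
        (fun n => (continuousOn (mlTerm a b lam mu c n).2).mono hsub)
        ((summable_geometric_two.mul_left M).mul_right C) fun n t ht => ?_
      refine (h n t ht.2).trans ?_
      gcongr
      exact (le_abs_self _).trans (hC t ht)
    exact (hct.continuousAt (Icc_mem_nhds (by linarith) (by linarith))).continuousWithinAt
  refine mem_of_integrableOn (fun t ht => ?_) hcont fun T hT => ?_
  · simp [eq_zero (mlTerm a b lam mu c _).2 ht]
  · obtain ⟨M, hM, h⟩ := exists_abs_mlTerm_le lam mu ha hb hc hT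
    have hφ : IntegrableOn (rlKernel c).1 (Ioc 0 T) :=
      ((locallyIntegrable (rlKernel c).2).integrableOn_isCompact isCompact_Icc).mono_set
        Ioc_subset_Icc_self
    refine Integrable.mono' (hφ.const_mul (∑' n : ℕ, M * (1 / 2) ^ n))
      ((hcont.mono Ioc_subset_Ioi_self).aestronglyMeasurable measurableSet_Ioc) ?_
    filter_upwards [ae_restrict_mem measurableSet_Ioc] with t ht
    rw [← tsum_mul_right]
    exact tsum_of_norm_bounded
      ((summable_geometric_two.mul_left M).mul_right _).hasSum fun n => h n t ht.2

/-- The kernel `t ^ (c - 1) * E_{a,b,c}(lam * t ^ a, mu * t ^ b)` as a causal function, for positive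
`a`, `b`, `c` (and `0` otherwise), written as the sum of its homogeneous parts; see
`mlKernel_eq_rpow_mul_bivariateMittagLeffler`. -/
noncomputable def mlKernel (a b lam mu c : ℝ) : CausalKernel :=
  if h : 0 < a ∧ 0 < b ∧ 0 < c then
    ⟨fun t => ∑' n, (mlTerm a b lam mu c n).1 t, tsum_mlTerm_mem lam mu h.1 h.2.1 h.2.2⟩
  else 0

theorem mlKernel_apply (ha : 0 < a) (hb : 0 < b) (hc : 0 < c) (t : ℝ) :
    (mlKernel a b lam mu c).1 t = ∑' n, (mlTerm a b lam mu c n).1 t := by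
  rw [mlKernel, dif_pos ⟨ha, hb, hc⟩]

/-- The resolvent equation `K_c = φ_c + lam K_{c+a} + mu K_{c+b}`: Pascal's rule for the
coefficients. -/
theorem mlKernel_eq (ha : 0 < a) (hb : 0 < b) (hc : 0 < c) :
    mlKernel a b lam mu c =
      rlKernel c + lam • mlKernel a b lam mu (c + a) + mu • mlKernel a b lam mu (c + b) := by
  refine ext_pos fun t _ => ?_
  simp only [Submodule.coe_add, Submodule.coe_smul, Pi.add_apply, Pi.smul_apply, smul_eq_mul]
  rw [mlKernel_apply lam mu ha hb hc, mlKernel_apply lam mu ha hb (by positivity : 0 < c + a),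
    mlKernel_apply lam mu ha hb (by positivity : 0 < c + b),
    (summable_mlTerm lam mu ha hb hc t).tsum_eq_zero_add, mlTerm_zero, add_assoc]
  congr 1
  rw [← tsum_mul_left, ← tsum_mul_left, ← Summable.tsum_add
    ((summable_mlTerm lam mu ha hb (by positivity) t).mul_left lam)
    ((summable_mlTerm lam mu ha hb (by positivity) t).mul_left mu)]
  refine tsum_congr fun n => ?_
  rw [mlTerm_succ]
  rfl

/-- Fractional integration shifts the last parameter. The series is integrated term by term. -/
theorem rlOp_mlKernel (ha : 0 < a) (hb : 0 < b) (hc : 0 < c) (hd : 0 ≤ d) :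
    rlOp d (mlKernel a b lam mu c) = mlKernel a b lam mu (c + d) := by
  rcases hd.eq_or_lt with rfl | hd'
  · rw [rlOp_zero, add_zero]
  refine ext_pos fun t ht => ?_
  obtain ⟨M, hM, h⟩ := exists_abs_mlTerm_le lam mu ha hb hc ht
  rw [mlKernel_apply lam mu ha hb (by positivity), rlOp_of_pos hd']
  show ∫ s, (rlKernel d).1 s * (mlKernel a b lam mu c).1 (t - s) = _
  have hterm : ∀ n, ∫ s, (rlKernel d).1 s * (mlTerm a b lam mu c n).1 (t - s) =
      (mlTerm a b lam mu (c + d) n).1 t := fun n => by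
    rw [← rlOp_mlTerm lam mu ha hb hc hd n, rlOp_of_pos hd']
    rfl
  have hi : ∀ n, Integrable fun s => (rlKernel d).1 s * (mlTerm a b lam mu c n).1 (t - s) :=
    fun n => convolutionExistsAt (rlKernel d).2 (mlTerm a b lam mu c n).2 t
  have hbound : ∀ (n : ℕ) (s : ℝ), ‖(rlKernel d).1 s * (mlTerm a b lam mu c n).1 (t - s)‖ ≤
      M * (1 / 2) ^ n * ((rlKernel d).1 s * (rlKernel c).1 (t - s)) := by
    intro n s
    rcases le_or_gt s 0 with hs | hs
    · simp [eq_zero (rlKernel d).2 hs]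
    rw [norm_mul, Real.norm_of_nonneg (rlKernel_nonneg d s)]
    calc _ ≤ (rlKernel d).1 s * (M * (1 / 2) ^ n * (rlKernel c).1 (t - s)) := by
          gcongr
          · exact rlKernel_nonneg d s
          · exact h n (t - s) (by linarith)
      _ = _ := by ring
  have hs := hasSum_integral_of_summable_integral_norm hi (by
    refine Summable.of_nonneg_of_le (fun n => integral_nonneg fun s => norm_nonneg _) (fun n => ?_)
      ((summable_geometric_two.mul_left M).mul_right
        (∫ s, (rlKernel d).1 s * (rlKernel c).1 (t - s)))
    rw [← integral_const_mul]
    exact integral_mono (hi n).norm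
      ((convolutionExistsAt (rlKernel d).2 (rlKernel c).2 t).const_mul _) (hbound n))
  simp only [hterm] at hs
  rw [hs.tsum_eq]
  refine integral_congr_ae (Eventually.of_forall fun s => ?_)
  simp only [mlKernel_apply lam mu ha hb hc, tsum_mul_left]

/-- The homogeneous parts are regrouped into the iterated sum over `l` and `k` that defines the
Mittag-Leffler function. -/
theorem mlKernel_eq_rpow_mul_bivariateMittagLeffler (ha : 0 < a) (hb : 0 < b) (hc : 0 < c)
    {t : ℝ} (ht : 0 < t) : (mlKernel a b lam mu c).1 t =
      t ^ (c - 1) * bivariateMittagLeffler a b c 1 (lam * t ^ a) (mu * t ^ b) := by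
  set F : ℕ × ℕ → ℝ := fun p => ((p.1 + p.2).choose p.1 : ℝ) *
    (lam ^ p.1 * mu ^ p.2 * (rlKernel (p.1 * a + p.2 * b + c)).1 t) with hF
  have hsum : Summable F := by
    obtain ⟨M, -, h⟩ := exists_rlKernel_le lam mu ha hb hc ht
    rw [← Finset.HasAntidiagonal.sigmaAntidiagonalEquivProd.summable_iff]
    refine Summable.of_norm ?_
    rw [summable_sigma_of_nonneg fun _ => norm_nonneg _]
    refine ⟨fun n => (hasSum_fintype _).summable, ?_⟩
    refine Summable.of_nonneg_of_le (fun n => tsum_nonneg fun _ => norm_nonneg _) (fun n => ?_)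
      ((summable_geometric_two.mul_left M).mul_right ((rlKernel c).1 t))
    refine le_trans (le_of_eq ?_) (h n t le_rfl)
    rw [tsum_fintype, ← Finset.sum_coe_sort (Finset.HasAntidiagonal.antidiagonal n)]
    refine Finset.sum_congr rfl fun ij _ => ?_
    have hij := Finset.HasAntidiagonal.mem_antidiagonal.1 ij.2
    simp only [hF, Function.comp_apply, Finset.HasAntidiagonal.sigmaAntidiagonalEquivProd_apply,
      norm_mul, norm_pow, Real.norm_eq_abs, abs_of_nonneg (rlKernel_nonneg _ _), Nat.abs_cast, hij]
  have hE : t ^ (c - 1) * bivariateMittagLeffler a b c 1 (lam * t ^ a) (mu * t ^ b) =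
      ∑' l : ℕ, ∑' k : ℕ, F (l, k) := by
    rw [bivariateMittagLeffler, ← tsum_mul_left]
    refine tsum_congr fun l => ?_
    rw [← tsum_mul_left]
    refine tsum_congr fun k => ?_
    have hpos : 0 < l * a + k * b + c := by positivity
    simp only [hF]
    rw [ascPochhammer_eval_one, rlKernel_apply hpos ht,
      ← Nat.add_choose_mul_factorial_mul_factorial l k, ← Nat.choose_symm_add, mul_pow, mul_pow,
      show (l : ℝ) * a + k * b + c - 1 = (c - 1) + (a * l + b * k) by ring, Real.rpow_add ht,
      Real.rpow_add ht, Real.rpow_mul ht.le, Real.rpow_mul ht.le, Real.rpow_natCast,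
      Real.rpow_natCast]
    have h1 := (Real.Gamma_pos_of_pos hpos).ne'
    have h2 : (l.factorial : ℝ) ≠ 0 := by positivity
    have h3 : (k.factorial : ℝ) ≠ 0 := by positivity
    push_cast
    field_simp
  rw [hE, ← hsum.tsum_prod, ← Finset.HasAntidiagonal.sigmaAntidiagonalEquivProd.tsum_eq F,
    Summable.tsum_sigma' (f := fun p => F (Finset.HasAntidiagonal.sigmaAntidiagonalEquivProd p))
      (fun n => (hasSum_fintype _).summable)
      (Finset.HasAntidiagonal.sigmaAntidiagonalEquivProd.summable_iff.2 hsum),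
    mlKernel_apply lam mu ha hb hc]
  refine tsum_congr fun n => ?_
  rw [coe_mlTerm, tsum_fintype, ← Finset.sum_coe_sort (Finset.HasAntidiagonal.antidiagonal n)]
  refine Finset.sum_congr rfl fun ij _ => ?_
  have hij := Finset.HasAntidiagonal.mem_antidiagonal.1 ij.2
  simp only [hF, Finset.HasAntidiagonal.sigmaAntidiagonalEquivProd_apply, hij]

end CausalKernel

namespace CausalKernel

/-! ### The Volterra equation -/

section Volterra

variable {a b c : ℝ} (lam mu : ℝ)

/-- The Volterra equation `y = I^c g + lam I^a y + mu I^b y` is solved by `y = K_c ⋆ g` and by nothing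
else. The resolvent equation gives existence; for uniqueness, write
`φ_c = K_c - lam I^a K_c - mu I^b K_c`, convolve with a solution `y` to get `I^c y = I^c (K_c ⋆ g)`,
and cancel `I^c`. -/
theorem eq_volterra_iff (ha : 0 < a) (hb : 0 < b) (hc : 0 < c) (g y : CausalKernel) :
    y = rlOp c g + lam • rlOp a y + mu • rlOp b y ↔ y = conv (mlKernel a b lam mu c) g := by
  set K := mlKernel a b lam mu c with hKdef
  have hK : K = rlKernel c + lam • rlOp a K + mu • rlOp b K := by
    rw [hKdef, rlOp_mlKernel lam mu ha hb hc ha.le, rlOp_mlKernel lam mu ha hb hc hb.le]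
    exact mlKernel_eq lam mu ha hb hc
  have hconv : ∀ f, conv K f = rlOp c f + lam • rlOp a (conv K f) + mu • rlOp b (conv K f) := by
    intro f
    conv_lhs => rw [hK]
    simp only [map_add, map_smul, LinearMap.add_apply, LinearMap.smul_apply,
      rlOp_conv_left ha.le, rlOp_conv_left hb.le, rlOp_of_pos hc]
  refine ⟨fun hy => rlOp_injective hc.le ?_, fun hy => ?_⟩
  · calc rlOp c y = conv K y - lam • rlOp a (conv K y) - mu • rlOp b (conv K y) := by
          linear_combination (norm := module) (-1 : ℝ) • hconv y
      _ = conv K (y - lam • rlOp a y - mu • rlOp b y) := by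
          simp only [map_sub, map_smul, rlOp_conv_right ha.le, rlOp_conv_right hb.le]
      _ = conv K (rlOp c g) := by
          congr 1
          linear_combination (norm := module) (1 : ℝ) • hy
      _ = rlOp c (conv K g) := (rlOp_conv_right hc.le K g).symm
  · rw [hy]
    exact hconv g

end Volterra

/-! ### Regularity of double integrals -/

section Regularity

variable {f g : CausalKernel} {y G : ℝ → ℝ}

theorem rlOp_one_eq_intervalIntegral (f : CausalKernel)
    (hf : EqOn f.1 G (Ioi 0)) {t : ℝ} (ht : 0 ≤ t) : (rlOp 1 f).1 t = ∫ s in 0..t, G s := by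
  rw [rlOp_one_apply f ht]
  refine intervalIntegral.integral_congr_ae (Eventually.of_forall fun s hs => ?_)
  rw [uIoc_of_le ht] at hs
  exact hf hs.1

theorem contDiff_intervalIntegral {n : ℕ} (hG : ContDiff ℝ n G) :
    ContDiff ℝ (n + 1) fun t => ∫ s in (0 : ℝ)..t, G s := by
  have hd : ∀ t, HasDerivAt (fun t => ∫ s in (0 : ℝ)..t, G s) (G t) t := fun t =>
    intervalIntegral.integral_hasDerivAt_right (hG.continuous.intervalIntegrable _ _)
      (hG.continuous.stronglyMeasurableAtFilter _ _) hG.continuous.continuousAt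
  refine contDiff_succ_iff_deriv.2 ⟨fun t => (hd t).differentiableAt, by simp, ?_⟩
  rwa [show deriv (fun t => ∫ s in (0 : ℝ)..t, G s) = G from funext fun t => (hd t).deriv]

theorem iteratedDeriv_two_eq (w : CausalKernel) (hy : EqOn y (rlOp 1 (rlOp 1 w)).1 (Ici 0)) {t : ℝ}
    (ht : 0 < t) : iteratedDeriv 2 y t = w.1 t := by
  have h1 : y =ᶠ[𝓝 t] (rlOp 1 (rlOp 1 w)).1 := by
    filter_upwards [Ioi_mem_nhds ht] with s hs using hy (mem_Ici.2 (le_of_lt hs))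
  rw [h1.iteratedDeriv_eq 2, iteratedDeriv_succ, iteratedDeriv_one]
  have h2 : deriv (rlOp 1 (rlOp 1 w)).1 =ᶠ[𝓝 t] (rlOp 1 w).1 := by
    filter_upwards [Ioi_mem_nhds ht] with s hs using (hasDerivAt_rlOp_one (rlOp 1 w) hs).deriv
  rw [h2.deriv_eq, (hasDerivAt_rlOp_one w ht).deriv]

/-- A double integral of a causal function `w` has second derivative `w` on `(0, ∞)`, hence is of the
class `IsCaputoRegular`. -/
theorem isCaputoRegular_of_eqOn (w : CausalKernel)
    (hy : EqOn y (rlOp 1 (rlOp 1 w)).1 (Ici 0)) : IsCaputoRegular y where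
  contDiff_one := by
    have h := contDiff_intervalIntegral (n := 0) (contDiff_zero.2 (continuous_rlOp_one w))
    refine (h.contDiffOn.of_le (by simp)).congr fun t ht => ?_
    rw [hy ht]
    exact rlOp_one_eq_intervalIntegral _ (eqOn_refl _ _) ht
  contDiff_two := by
    have hd : ∀ f : CausalKernel, DifferentiableOn ℝ (rlOp 1 f).1 (Ioi 0) := fun f t ht =>
      (hasDerivAt_rlOp_one f ht).differentiableAt.differentiableWithinAt
    have hd' : ∀ f : CausalKernel, EqOn (deriv (rlOp 1 f).1) f.1 (Ioi 0) := fun f t ht =>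
      (hasDerivAt_rlOp_one f ht).deriv
    have h1 : ContDiffOn ℝ 1 (rlOp 1 w).1 (Ioi 0) := by
      rw [show (1 : WithTop ℕ∞) = 0 + 1 by simp, contDiffOn_succ_iff_deriv_of_isOpen isOpen_Ioi]
      exact ⟨hd w, by simp, contDiffOn_zero.2 ((continuousOn w.2).congr (hd' w))⟩
    have h2 : ContDiffOn ℝ 2 (rlOp 1 (rlOp 1 w)).1 (Ioi 0) := by
      rw [show (2 : WithTop ℕ∞) = 1 + 1 by norm_num, contDiffOn_succ_iff_deriv_of_isOpen isOpen_Ioi]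
      exact ⟨hd _, by simp, h1.congr (hd' _)⟩
    exact h2.congr (hy.mono Ioi_subset_Ici_self)
  integrable_deriv T _ :=
    (((locallyIntegrable w.2).integrableOn_isCompact isCompact_Icc).mono_set
      Ioc_subset_Icc_self).congr_fun (fun _ ht => (iteratedDeriv_two_eq w hy ht.1).symm)
        measurableSet_Ioc

/-- If `w` extends continuously to `[0, ∞)`, its double integral is `C²` up to `0`. -/
theorem contDiffOn_two_of_eqOn (w : CausalKernel) (hy : EqOn y (rlOp 1 (rlOp 1 w)).1 (Ici 0))
    (hG : ContinuousOn G (Ici 0)) (hw : EqOn w.1 G (Ioi 0)) : ContDiffOn ℝ 2 y (Ici 0) := by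
  have hG' : Continuous fun t => G (max t 0) :=
    hG.comp_continuous (by fun_prop) fun t => mem_Ici.2 (le_max_right t 0)
  have hw' : EqOn w.1 (fun t => G (max t 0)) (Ioi 0) := fun t ht => by
    simp only [hw ht, max_eq_left (le_of_lt (mem_Ioi.1 ht))]
  have h1 := contDiff_intervalIntegral (n := 0) (contDiff_zero.2 hG')
  have h2 := contDiff_intervalIntegral (n := 1) (by simpa using h1)
  rw [show ((1 : ℕ) : WithTop ℕ∞) + 1 = 2 by norm_num] at h2
  refine h2.contDiffOn.congr fun t ht => ?_
  rw [hy ht]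
  exact rlOp_one_eq_intervalIntegral _
    (fun s hs => rlOp_one_eq_intervalIntegral w hw' (le_of_lt hs)) ht

end Regularity

/-! ### Continuous right-hand sides and the solution formula -/

/-- The causal function that agrees with `g` on `(0, ∞)`; the value at `0` is replaced by `0`. -/
noncomputable def ofContinuousOn {g : ℝ → ℝ} (hg : ContinuousOn g (Ici 0)) : CausalKernel :=
  ⟨(Ioi 0).indicator g, indicator_mem_of_continuousOn hg⟩

theorem ofContinuousOn_apply {g : ℝ → ℝ} (hg : ContinuousOn g (Ici 0)) {t : ℝ} (ht : 0 < t) :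
    (ofContinuousOn hg).1 t = g t := indicator_of_mem (s := Ioi (0 : ℝ)) ht g

/-- The fundamental theorem of calculus `g = g(0) + ∫ g'`, among causal functions; `rlKernel 1` is the
constant `1` on `(0, ∞)`. -/
theorem ofContinuousOn_eq {g : ℝ → ℝ} (hg : ContDiffOn ℝ 1 g (Ici 0)) :
    ofContinuousOn hg.continuousOn = g 0 • rlKernel 1 + rlOp 1 (ofContinuousOn
      (hg.continuousOn_derivWithin (uniqueDiffOn_Ici 0) le_rfl)) := by
  refine ext_pos fun t ht => ?_
  have h := eq_rlOp_one (F := fun t => g t - g 0) (ofContinuousOn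
      (hg.continuousOn_derivWithin (uniqueDiffOn_Ici 0) le_rfl))
    (hg.continuousOn.sub continuousOn_const) (sub_self _) (fun s hs => ?_) ht.le
  · rw [Submodule.coe_add, Submodule.coe_smul, Pi.add_apply, ← h, ofContinuousOn_apply _ ht,
      Pi.smul_apply, rlKernel_apply one_pos ht]
    simp
  · rw [ofContinuousOn_apply _ hs]
    refine HasDerivAt.sub_const _ ?_
    exact ((hg.differentiableOn one_ne_zero s hs.le).hasDerivWithinAt).hasDerivAt
      (Ici_mem_nhds hs)

end CausalKernel

open CausalKernel

theorem bagleyTorvikFormula_eq_conv {α β : ℝ} (lam mu : ℝ) (hα : 0 < α) (hβ : β < α) {g : ℝ → ℝ}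
    (hg : ContinuousOn g (Ici 0)) {t : ℝ} (ht : 0 ≤ t) :
    bagleyTorvikFormula α β lam mu g t =
      (conv (mlKernel α (α - β) lam mu α) (ofContinuousOn hg)).1 t := by
  rw [conv_apply _ _ ht, bagleyTorvikFormula]
  refine intervalIntegral.integral_congr_ae ?_
  have : ∀ᵐ s : ℝ, s ≠ t := by simp [ae_iff, measure_singleton]
  filter_upwards [this] with s hst hs
  rw [uIoc_of_le ht] at hs
  have : s < t := lt_of_le_of_ne hs.2 hst
  rw [ofContinuousOn_apply hg hs.1, mlKernel_eq_rpow_mul_bivariateMittagLeffler lam mu hα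
    (sub_pos.2 hβ) hα (sub_pos.2 this)]

/-! ### Regular functions -/

theorem ContDiffOn.isCaputoRegular {y : ℝ → ℝ} (hy : ContDiffOn ℝ 2 y (Ici 0)) :
    IsCaputoRegular y where
  contDiff_one := hy.of_le (by norm_num)
  contDiff_two := hy.mono Ioi_subset_Ici_self
  integrable_deriv T _ := by
    have h1 : ContDiffOn ℝ 1 (derivWithin y (Ici 0)) (Ici 0) :=
      hy.derivWithin (uniqueDiffOn_Ici 0) (by norm_num)
    have h2 := h1.continuousOn_derivWithin (uniqueDiffOn_Ici 0) le_rfl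
    refine ((h2.mono Icc_subset_Ici_self).integrableOn_Icc.mono_set Ioc_subset_Icc_self).congr_fun
      (fun t ht => ?_) measurableSet_Ioc
    have h3 : deriv y =ᶠ[𝓝 t] derivWithin y (Ici 0) := by
      filter_upwards [Ioi_mem_nhds ht.1] with s hs
      exact (derivWithin_of_mem_nhds (Ici_mem_nhds hs)).symm
    rw [iteratedDeriv_succ, iteratedDeriv_one, h3.deriv_eq,
      derivWithin_of_mem_nhds (Ici_mem_nhds ht.1)]

namespace IsCaputoRegular

variable {y : ℝ → ℝ}

theorem hasDerivAt (hy : IsCaputoRegular y) {t : ℝ} (ht : 0 < t) : HasDerivAt y (deriv y t) t :=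
  ((hy.contDiff_two.differentiableOn two_ne_zero).differentiableAt (Ioi_mem_nhds ht)).hasDerivAt

theorem hasDerivAt_deriv (hy : IsCaputoRegular y) {t : ℝ} (ht : 0 < t) :
    HasDerivAt (deriv y) (iteratedDeriv 2 y t) t := by
  rw [iteratedDeriv_succ, iteratedDeriv_one]
  have h : ContDiffOn ℝ 1 (deriv y) (Ioi 0) :=
    hy.contDiff_two.deriv_of_isOpen isOpen_Ioi (by norm_num)
  exact ((h.differentiableOn one_ne_zero).differentiableAt (Ioi_mem_nhds ht)).hasDerivAt

theorem continuousOn_derivWithin (hy : IsCaputoRegular y) :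
    ContinuousOn (derivWithin y (Ici 0)) (Ici 0) :=
  hy.contDiff_one.continuousOn_derivWithin (uniqueDiffOn_Ici 0) le_rfl

theorem iteratedDeriv_mem (hy : IsCaputoRegular y) :
    (Ioi 0).indicator (iteratedDeriv 2 y) ∈ CausalKernel := by
  refine indicator_mem ?_ hy.integrable_deriv
  rw [iteratedDeriv_succ, iteratedDeriv_one]
  have h : ContDiffOn ℝ 1 (deriv y) (Ioi 0) :=
    hy.contDiff_two.deriv_of_isOpen isOpen_Ioi (by norm_num)
  exact h.continuousOn_deriv_of_isOpen isOpen_Ioi le_rfl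

end IsCaputoRegular

/-! ### The Cauchy problem -/

section Problem

variable {α β lam mu : ℝ} {g y : ℝ → ℝ}

/-- For orders `α ∈ (1, 2]` and `β ∈ (0, 1]` the Caputo equation at all `t > 0` is an identity between
causal functions, with `y₁` and `y₂` standing for `y'` and `y''`. -/
theorem caputoDeriv_equation_iff (hα : 1 < α) (hα' : α ≤ 2) (hβ : 0 < β) (hβ' : β ≤ 1)
    (hg : ContinuousOn g (Ici 0)) {y₀ y₁ y₂ : CausalKernel} (h0 : EqOn y y₀.1 (Ioi 0))
    (h1 : EqOn (deriv y) y₁.1 (Ioi 0)) (h2 : EqOn (iteratedDeriv 2 y) y₂.1 (Ioi 0)) :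
    (∀ t : ℝ, 0 < t → caputoDeriv 0 α y t - mu * caputoDeriv 0 β y t - lam * y t = g t) ↔
      rlOp (2 - α) y₂ - mu • rlOp (1 - β) y₁ - lam • y₀ = ofContinuousOn hg := by
  have hceil2 : ⌈α⌉₊ = 2 := by
    rw [Nat.ceil_eq_iff two_ne_zero]
    norm_num
    exact ⟨hα, hα'⟩
  have hceil1 : ⌈β⌉₊ = 1 := by
    rw [Nat.ceil_eq_iff one_ne_zero]
    norm_num
    exact ⟨hβ, hβ'⟩
  have key : ∀ t, 0 < t → caputoDeriv 0 α y t - mu * caputoDeriv 0 β y t - lam * y t =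
      (rlOp (2 - α) y₂ - mu • rlOp (1 - β) y₁ - lam • y₀).1 t := by
    intro t ht
    have e2 : caputoDeriv 0 α y t = (rlOp (2 - α) y₂).1 t := by
      rw [caputoDeriv, hceil2, Nat.cast_ofNat]
      exact rlIntegral_eq_rlOp (by linarith) ht y₂ h2
    have e1 : caputoDeriv 0 β y t = (rlOp (1 - β) y₁).1 t := by
      rw [caputoDeriv, hceil1, Nat.cast_one, iteratedDeriv_one]
      exact rlIntegral_eq_rlOp (by linarith) ht y₁ h1
    rw [e1, e2, h0 ht]
    rfl
  refine ⟨fun h => ext_pos fun t ht => ?_, fun h t ht => ?_⟩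
  · rw [← key t ht, h t ht, ofContinuousOn_apply hg ht]
  · rw [key t ht, h, ofContinuousOn_apply hg ht]

/-- Under zero initial data, where `y = I² y''`, applying the injective operator `I^α` turns the Caputo
equation into a Volterra equation for `y`. -/
theorem caputo_equation_iff_volterra (hα : 1 < α) (hα' : α ≤ 2) (hβ' : β ≤ 1)
    (f y₂ : CausalKernel) :
    rlOp (2 - α) y₂ - mu • rlOp (1 - β) (rlOp 1 y₂) - lam • rlOp 1 (rlOp 1 y₂) = f ↔
      rlOp 1 (rlOp 1 y₂) = rlOp α f + lam • rlOp α (rlOp 1 (rlOp 1 y₂)) +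
        mu • rlOp (α - β) (rlOp 1 (rlOp 1 y₂)) := by
  have hα0 : 0 ≤ α := by linarith
  have e2 : rlOp α (rlOp (2 - α) y₂) = rlOp 1 (rlOp 1 y₂) := by
    rw [← rlOp_add hα0 (by linarith), ← rlOp_add zero_le_one zero_le_one]
    congr 2
    ring
  have e1 : rlOp α (rlOp (1 - β) (rlOp 1 y₂)) = rlOp (α - β) (rlOp 1 (rlOp 1 y₂)) := by
    rw [← rlOp_add hα0 (by linarith), show α + (1 - β) = α - β + 1 by ring,
      rlOp_add (by linarith) zero_le_one]
  rw [← (rlOp_injective hα0).eq_iff, map_sub, map_sub, map_smul, map_smul, e1, e2]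
  constructor <;> intro h
  · linear_combination (norm := module) (1 : ℝ) • h
  · linear_combination (norm := module) (1 : ℝ) • h

/-- The derivatives of a regular function, as causal functions `y₁` and `y₂`. That `y` and `y'` are
their integrals uses the initial values. -/
theorem IsCaputoRegular.exists_causalKernel (hy : IsCaputoRegular y) (h0 : y 0 = 0) :
    ∃ y₁ y₂ : CausalKernel, EqOn (derivWithin y (Ici 0)) y₁.1 (Ioi 0) ∧
      EqOn (deriv y) y₁.1 (Ioi 0) ∧ EqOn (iteratedDeriv 2 y) y₂.1 (Ioi 0) ∧
      EqOn y (rlOp 1 y₁).1 (Ici 0) ∧ (derivWithin y (Ici 0) 0 = 0 → y₁ = rlOp 1 y₂) := by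
  have hd : ∀ t, 0 < t → derivWithin y (Ici 0) t = deriv y t := fun t ht =>
    derivWithin_of_mem_nhds (Ici_mem_nhds ht)
  have e2 : ∀ t, 0 < t → (Ioi 0).indicator (iteratedDeriv 2 y) t = iteratedDeriv 2 y t :=
    fun t ht => indicator_of_mem (s := Ioi (0 : ℝ)) ht _
  have e1 : ∀ t, 0 < t → (ofContinuousOn hy.continuousOn_derivWithin).1 t = deriv y t :=
    fun t ht => by rw [ofContinuousOn_apply _ ht, hd t ht]
  refine ⟨ofContinuousOn hy.continuousOn_derivWithin, ⟨_, hy.iteratedDeriv_mem⟩,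
    fun t ht => (ofContinuousOn_apply _ ht).symm, fun t ht => (e1 t ht).symm,
    fun t ht => (e2 t ht).symm, fun t ht => ?_, fun h => ext_pos fun t ht => ?_⟩
  · refine eq_rlOp_one _ hy.contDiff_one.continuousOn h0 (fun s hs => ?_) ht
    rw [e1 s hs]
    exact hy.hasDerivAt hs
  · rw [ofContinuousOn_apply _ ht]
    refine eq_rlOp_one _ hy.continuousOn_derivWithin h (fun s hs => ?_) ht.le
    change HasDerivAt _ ((Ioi 0).indicator (iteratedDeriv 2 y) s) s
    rw [e2 s hs]
    refine (hy.hasDerivAt_deriv hs).congr_of_eventuallyEq ?_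
    filter_upwards [Ioi_mem_nhds hs] with r hr using hd r hr

/-- In the class `IsCaputoRegular` the problem is solved exactly by the Mittag-Leffler formula. Both
directions pass through the Volterra equation; in the converse direction the condition `y'(0) = 0` has
to be recovered, which is done by differentiating the Volterra equation once. -/
theorem IsCaputoRegular.isBagleyTorvikSolution_iff (hy : IsCaputoRegular y) (hα : 1 < α)
    (hα' : α ≤ 2) (hβ : 0 < β) (hβ' : β ≤ 1) (hg : ContinuousOn g (Ici 0)) :
    IsBagleyTorvikSolution α β lam mu g y ↔
      EqOn y (bagleyTorvikFormula α β lam mu g) (Ici 0) := by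
  have hα0 : 0 < α := by linarith
  have hαβ : 0 < α - β := by linarith
  set f := ofContinuousOn hg
  have hY : ∀ t, 0 ≤ t → bagleyTorvikFormula α β lam mu g t =
      (conv (mlKernel α (α - β) lam mu α) f).1 t := fun t ht =>
    bagleyTorvikFormula_eq_conv lam mu hα0 (by linarith) hg ht
  constructor
  · intro h t ht
    obtain ⟨y₁, y₂, -, h1, h2, h01, h12⟩ := hy.exists_causalKernel h.value_zero
    obtain rfl := h12 h.deriv_zero
    have heq := (caputoDeriv_equation_iff hα hα' hβ hβ' hg (h01.mono Ioi_subset_Ici_self) h1 h2).1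
      h.equation
    rw [caputo_equation_iff_volterra hα hα' hβ', eq_volterra_iff lam mu hα0 hαβ hα0] at heq
    rw [hY t ht, ← heq, h01 ht]
  · intro h
    have h0 : y 0 = 0 := by
      rw [h self_mem_Ici, bagleyTorvikFormula, intervalIntegral.integral_same]
    obtain ⟨y₁, y₂, hw, h1, h2, h01, h12⟩ := hy.exists_causalKernel h0
    have hV : rlOp 1 y₁ = conv (mlKernel α (α - β) lam mu α) f := ext_pos fun t ht => by
      rw [← h01 (mem_Ici.2 ht.le), h (mem_Ici.2 ht.le), hY t ht.le]
    rw [← eq_volterra_iff lam mu hα0 hαβ hα0] at hV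
    -- the Volterra equation differentiated once, with `α - 1 > 0` and `α - β > 0` left as orders
    have hV' : y₁ = conv (rlKernel (α - 1)) (f + lam • rlOp 1 y₁) +
        mu • conv (rlKernel (α - β)) y₁ := by
      apply rlOp_one_injective
      have e1 : ∀ z, rlOp α z = rlOp 1 (conv (rlKernel (α - 1)) z) := fun z => by
        rw [← rlOp_of_pos (by linarith), ← rlOp_add zero_le_one (by linarith)]
        congr 2
        ring
      refine hV.trans ?_
      rw [e1, e1, rlOp_comm hαβ.le zero_le_one, rlOp_of_pos hαβ]
      simp only [map_add, map_smul]
    -- both convolutions on the right are continuous and vanish at `0`, so `y'` tends to `0` there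
    have hd : derivWithin y (Ici 0) 0 = 0 := by
      have hc1 := continuous_conv_of_eqOn (rlKernel (α - 1)) (f + lam • rlOp 1 y₁)
        (G := fun t => g t + lam * y t) (hg.add (hy.contDiff_one.continuousOn.const_smul lam))
        fun t ht => by
          rw [Submodule.coe_add, Submodule.coe_smul, Pi.add_apply, Pi.smul_apply,
            ofContinuousOn_apply hg ht, ← h01 (Ioi_subset_Ici_self ht), smul_eq_mul]
      have hc2 := continuous_conv_of_eqOn (rlKernel (α - β)) y₁ hy.continuousOn_derivWithin hw.symm
      have hc : Continuous y₁.1 := by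
        rw [hV']
        exact hc1.add (hc2.const_smul mu)
      have l1 : Tendsto y₁.1 (𝓝[>] 0) (𝓝 0) := by
        have := hc.tendsto 0
        rw [eq_zero y₁.2 le_rfl] at this
        exact this.mono_left nhdsWithin_le_nhds
      have l2 : Tendsto y₁.1 (𝓝[>] 0) (𝓝 (derivWithin y (Ici 0) 0)) := by
        have := (hy.continuousOn_derivWithin 0 self_mem_Ici).mono Ioi_subset_Ici_self
        exact this.tendsto.congr' (eventually_mem_nhdsWithin.mono hw)
      exact tendsto_nhds_unique l2 l1
    obtain rfl := h12 hd
    refine ⟨?_, h0, hd⟩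
    rw [caputoDeriv_equation_iff hα hα' hβ hβ' hg (h01.mono Ioi_subset_Ici_self) h1 h2,
      caputo_equation_iff_volterra hα hα' hβ']
    exact hV

/-- For `g` of class `C¹`, writing `g = g(0) + ∫ g'` exhibits the solution formula as a double
integral of `g(0) K_{α-1} + K_{α-1} ⋆ g'`. -/
theorem rlOp_rlOp_eq_conv_mlKernel (hα : 1 < α) (hαβ : β < α) (hg : ContDiffOn ℝ 1 g (Ici 0)) :
    rlOp 1 (rlOp 1 (g 0 • mlKernel α (α - β) lam mu (α - 1) +
      conv (mlKernel α (α - β) lam mu (α - 1)) (ofContinuousOn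
        (hg.continuousOn_derivWithin (uniqueDiffOn_Ici 0) le_rfl)))) =
    conv (mlKernel α (α - β) lam mu α) (ofContinuousOn hg.continuousOn) := by
  have hK : rlOp 1 (mlKernel α (α - β) lam mu (α - 1)) = mlKernel α (α - β) lam mu α := by
    rw [rlOp_mlKernel lam mu (by linarith) (by linarith) (by linarith) zero_le_one, sub_add_cancel]
  rw [ofContinuousOn_eq hg]
  simp only [map_add, map_smul, rlOp_conv_left zero_le_one, hK]
  rw [conv_comm _ (rlKernel 1), ← rlOp_of_pos one_pos, ← rlOp_conv_left zero_le_one,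
    ← rlOp_conv_right zero_le_one]

/-- For `α = 2` the solution formula is a double integral without any differentiability of `g`,
because the leading term of the kernel is the kernel of `I²` itself. -/
theorem rlOp_rlOp_eq_conv_mlKernel_two (hβ : β < 2) (f : CausalKernel) :
    rlOp 1 (rlOp 1 (f + conv (lam • mlKernel 2 (2 - β) lam mu 2 +
      mu • mlKernel 2 (2 - β) lam mu (2 - β)) f)) = conv (mlKernel 2 (2 - β) lam mu 2) f := by
  have hb : 0 < 2 - β := by linarith
  rw [← rlOp_add zero_le_one zero_le_one, show (1 : ℝ) + 1 = 2 by norm_num, map_add,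
    rlOp_conv_left zero_le_two, rlOp_of_pos two_pos, map_add, map_smul, map_smul,
    rlOp_mlKernel lam mu two_pos hb two_pos zero_le_two,
    rlOp_mlKernel lam mu two_pos hb hb zero_le_two, add_comm (2 - β) 2]
  conv_rhs => rw [mlKernel_eq lam mu two_pos hb two_pos]
  simp only [map_add, LinearMap.add_apply, add_assoc]

end Problem

theorem mainTheorem8 (α β lam mu : ℝ) (hα : 1 < α) (hα' : α ≤ 2) (hβ : 0 < β) (hβ' : β ≤ 1)
    (g : ℝ → ℝ) (hg : ContinuousOn g (Set.Ici 0)) :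
    (∀ y : ℝ → ℝ, ContDiffOn ℝ 2 y (Set.Ici 0) →
      (IsBagleyTorvikSolution α β lam mu g y ↔
        Set.EqOn y (bagleyTorvikFormula α β lam mu g) (Set.Ici 0))) ∧
    (∀ y : ℝ → ℝ, IsCaputoRegular y →
      (IsBagleyTorvikSolution α β lam mu g y ↔
        Set.EqOn y (bagleyTorvikFormula α β lam mu g) (Set.Ici 0))) ∧
    (ContDiffOn ℝ 1 g (Set.Ici 0) →
      IsCaputoRegular (bagleyTorvikFormula α β lam mu g) ∧
      IsBagleyTorvikSolution α β lam mu g (bagleyTorvikFormula α β lam mu g)) ∧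
    ((α = 2 ∨ (ContDiffOn ℝ 1 g (Set.Ici 0) ∧ g 0 = 0)) →
      ContDiffOn ℝ 2 (bagleyTorvikFormula α β lam mu g) (Set.Ici 0) ∧
      IsBagleyTorvikSolution α β lam mu g (bagleyTorvikFormula α β lam mu g)) := by
  have hiff : ∀ y : ℝ → ℝ, IsCaputoRegular y → (IsBagleyTorvikSolution α β lam mu g y ↔
      Set.EqOn y (bagleyTorvikFormula α β lam mu g) (Set.Ici 0)) := fun y hy =>
    hy.isBagleyTorvikSolution_iff hα hα' hβ hβ' hg
  have hsol : IsCaputoRegular (bagleyTorvikFormula α β lam mu g) →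
      IsBagleyTorvikSolution α β lam mu g (bagleyTorvikFormula α β lam mu g) := fun h =>
    (hiff _ h).2 (eqOn_refl _ _)
  have hα0 : 0 < α := by linarith
  have hβα : β < α := by linarith
  refine ⟨fun y hy => hiff y hy.isCaputoRegular, hiff, fun hg1 => ?_, fun h => ?_⟩
  · have hreg : IsCaputoRegular (bagleyTorvikFormula α β lam mu g) :=
      isCaputoRegular_of_eqOn _ fun t ht => by
        rw [rlOp_rlOp_eq_conv_mlKernel hα hβα hg1]
        exact bagleyTorvikFormula_eq_conv lam mu hα0 hβα hg ht
    exact ⟨hreg, hsol hreg⟩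
  · have hreg : ContDiffOn ℝ 2 (bagleyTorvikFormula α β lam mu g) (Set.Ici 0) := by
      rcases h with rfl | ⟨hg1, hg0⟩
      · have hc := continuous_conv_of_eqOn (lam • mlKernel 2 (2 - β) lam mu 2 +
          mu • mlKernel 2 (2 - β) lam mu (2 - β)) (ofContinuousOn hg) hg
          fun t ht => ofContinuousOn_apply hg ht
        refine contDiffOn_two_of_eqOn (ofContinuousOn hg + conv (lam • mlKernel 2 (2 - β) lam mu 2 +
          mu • mlKernel 2 (2 - β) lam mu (2 - β)) (ofContinuousOn hg)) (fun t ht => ?_)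
          (hg.add hc.continuousOn) fun t ht => ?_
        · rw [rlOp_rlOp_eq_conv_mlKernel_two hβα]
          exact bagleyTorvikFormula_eq_conv lam mu hα0 hβα hg ht
        · rw [Submodule.coe_add, Pi.add_apply, ofContinuousOn_apply hg ht]
          rfl
      · have hg' := hg1.continuousOn_derivWithin (uniqueDiffOn_Ici 0) le_rfl
        have hc := continuous_conv_of_eqOn (mlKernel α (α - β) lam mu (α - 1)) (ofContinuousOn hg')
          hg' fun t ht => ofContinuousOn_apply hg' ht
        refine contDiffOn_two_of_eqOn _ (fun t ht => ?_) hc.continuousOn (eqOn_refl _ _)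
        have h2 := rlOp_rlOp_eq_conv_mlKernel (lam := lam) (mu := mu) hα hβα hg1
        rw [hg0, zero_smul, zero_add] at h2
        rw [h2]
        exact bagleyTorvikFormula_eq_conv lam mu hα0 hβα hg ht
    exact ⟨hreg, hsol hreg.isCaputoRegular⟩
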